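/- Let $n\ge 0$ and let $\Omega\subset\mathbb{C}^n$ be a simply connected domain, that is, a nonempty open connected set with trivial fundamental group. Write $z_j=x_j+iy_j$ for the coordinates of $\mathbb{C}^n$. A real-valued function $\varphi$ on $\Omega$ is called pluriharmonic if it is of class $C^2$ in the real variables $x_1,y_1,\dots,x_n,y_n$ and satisfies, for all $j,k\in\{1,\dots,n\}$, $$\frac{\partial^2\varphi}{\partial x_j\,\partial x_k}+\frac{\partial^2\varphi}{\partial y_j\,\partial y_k}=0\qquad\text{and}\qquad \frac{\partial^2\varphi}{\partial x_j\,\partial y_k}-\frac{\partial^2\varphi}{\partial x_k\,\partial y_j}=0\qquad\text{on }\Omega .$$ A complex-valued function $f=u+iv$ on $\Omega$ is called pluriharmonic if its real part $u$ and its imaginary part $v$ are both pluriharmonic. **Proposition 1.2.** If $f:\Omega\to\mathbb{C}$ is pluriharmonic, then there exist holomorphic functions $h,g:\Omega\to\mathbb{C}$ such that $f=h+\overline{g}$ on $\Omega$. -/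

import Mathlib

/-- The partial derivative `∂φ/∂x_j` at `z`, for a real-valued function `φ` of
`z = (x_1 + i y_1, …, x_n + i y_n)`. -/
noncomputable def partialX {n : ℕ} (j : Fin n) (φ : (Fin n → ℂ) → ℝ) (z : Fin n → ℂ) : ℝ :=
  lineDeriv ℝ φ z (Pi.single j 1)

/-- The partial derivative `∂φ/∂y_j` at `z`, for a real-valued function `φ` of
`z = (x_1 + i y_1, …, x_n + i y_n)`. -/
noncomputable def partialY {n : ℕ} (j : Fin n) (φ : (Fin n → ℂ) → ℝ) (z : Fin n → ℂ) : ℝ :=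
  lineDeriv ℝ φ z (Pi.single j Complex.I)

/-- A real-valued function is pluriharmonic on an open set `Ω ⊆ ℂⁿ` if it is of class `C²` there
(as a function of the `2n` real variables) and, for all `j, k`,
`∂²φ/∂x_j∂x_k + ∂²φ/∂y_j∂y_k = 0` and `∂²φ/∂x_j∂y_k - ∂²φ/∂x_k∂y_j = 0` on `Ω`. -/
structure RealPluriharmonicOn {n : ℕ} (φ : (Fin n → ℂ) → ℝ) (Ω : Set (Fin n → ℂ)) : Prop where
  contDiffOn : ContDiffOn ℝ 2 φ Ω
  eq_xx_yy : ∀ z ∈ Ω, ∀ j k : Fin n,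
    partialX j (partialX k φ) z + partialY j (partialY k φ) z = 0
  eq_xy_yx : ∀ z ∈ Ω, ∀ j k : Fin n,
    partialX j (partialY k φ) z - partialX k (partialY j φ) z = 0

/-- A complex-valued function is pluriharmonic if its real and imaginary parts are. -/
structure ComplexPluriharmonicOn {n : ℕ} (f : (Fin n → ℂ) → ℂ) (Ω : Set (Fin n → ℂ)) :
    Prop where
  re : RealPluriharmonicOn (fun z => (f z).re) Ω
  im : RealPluriharmonicOn (fun z => (f z).im) Ω

/-!
A real pluriharmonic function `φ` is the real part of a holomorphic function: the pluriharmonic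
equations say exactly that the `1`-form `v ↦ -dφ(iv)` is closed
(`RealPluriharmonicOn.fderiv_fderiv_apply_I_smul`), so on a simply connected open set it has a
primitive `ψ`, and then `d(φ + iψ)` is complex linear
(`RealPluriharmonicOn.exists_differentiableOn_re_eq`). If the real and imaginary parts of `f` are
`Re P` and `Re Q` with `P`, `Q` holomorphic, then `f` is a combination of `P`, `Q` and their
conjugates.

Primitives of closed forms on a simply connected open set
(`IsSimplyConnected.exists_forall_hasFDerivAt`) come from Mathlib's Poincaré lemma on convex sets.
The primitives on balls differ by locally constant functions, so they are the transition data of a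
covering space; simple connectedness gives it a global section
(`exists_locallyConstant_sub_of_simplyConnected`).
-/

open Filter
open scoped Topology

/-- If local functions `p i` on an open cover of a simply connected space differ by locally
constant functions on overlaps, some global function differs from each `p i` by a locally constant
function on `U i`. The values that such a global function may take, relative to the `p i`, form a
bundle with discrete fibre; its projection is a covering map, and a lift of the identity through
it is the required function. -/
theorem exists_locallyConstant_sub_of_simplyConnected {X A ι : Type*} [TopologicalSpace X]
    [SimplyConnectedSpace X] [LocallyPathConnectedSpace X] [AddCommGroup A]
    (U : ι → Set X) (hU : ∀ i, IsOpen (U i)) (hcov : ∀ x, ∃ i, x ∈ U i) (p : ι → X → A)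
    (hp : ∀ i j, ∀ x ∈ U i ∩ U j, ∀ᶠ y in 𝓝 x, p i y - p j y = p i x - p j x) :
    ∃ Φ : X → A, ∀ i, ∀ x ∈ U i, ∀ᶠ y in 𝓝 x, Φ y - p i y = Φ x - p i x := by
  -- The discrete topology on the fibre makes the bundle `Z` below a covering space.
  let _ : TopologicalSpace A := ⊥
  have : DiscreteTopology A := ⟨rfl⟩
  choose idx hidx using hcov
  let Z : FiberBundleCore ι X A :=
    { baseSet := U
      isOpen_baseSet := hU
      indexAt := idx
      mem_baseSet_at := hidx
      coordChange := fun i j x v => v + (p i x - p j x)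
      coordChange_self := by simp
      continuousOn_coordChange := by
        rintro i j ⟨x, v⟩ ⟨hx, -⟩
        have h : ContinuousAt (fun y => p i y - p j y) x :=
          continuousAt_const.congr ((hp i j x hx).mono fun y hy => hy.symm)
        have h' : ContinuousAt (fun q : X × A => p i q.1 - p j q.1) (x, v) :=
          ContinuousAt.comp (f := Prod.fst) (x := (x, v)) h continuousAt_fst
        exact (continuousAt_snd.add h').continuousWithinAt
      coordChange_comp := by intros; abel }
  have hcm : IsCoveringMap Z.proj := FiberBundle.isCoveringMap (F := A) (E := Z.Fiber)
  obtain ⟨x₀⟩ : Nonempty X := inferInstance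
  obtain ⟨s, ⟨-, hs⟩, -⟩ := hcm.existsUnique_continuousMap_lifts (ContinuousMap.id X) x₀
    (⟨x₀, (0 : A)⟩ : Z.TotalSpace) rfl
  have hs' : ∀ x, (s x).proj = x := fun x => congrFun hs x
  refine ⟨fun x => (show A from (s x).2) + p (idx x) x, fun i x hx => ?_⟩
  have hc : ContinuousAt (fun y => (Z.localTriv i (s y)).2) x := by
    have h1 : ContinuousAt (Z.localTriv i) (s x) :=
      (Z.localTriv i).continuousAt ((Z.mem_localTriv_source i _).2 (by
        change (s x).proj ∈ U i
        rwa [hs']))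
    exact continuousAt_snd.comp (ContinuousAt.comp h1 s.continuous.continuousAt)
  have key : ∀ y, (Z.localTriv i (s y)).2 = (show A from (s y).2) + (p (idx y) y - p i y) := by
    intro y
    change (show A from (s y).2) + (p (idx (s y).proj) (s y).proj - p i (s y).proj) = _
    rw [hs']
  rw [ContinuousAt, nhds_discrete A, tendsto_pure] at hc
  filter_upwards [hc] with y hy
  rw [key, key] at hy
  exact (add_sub_assoc _ _ _).trans (hy.trans (add_sub_assoc _ _ _).symm)

/-- The Poincaré lemma for `1`-forms on a simply connected open set: primitives exist on balls,
where they are unique up to constants, and simple connectedness glues them. -/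
theorem IsSimplyConnected.exists_forall_hasFDerivAt {E F : Type*} [NormedAddCommGroup E]
    [NormedSpace ℝ E] [NormedAddCommGroup F] [NormedSpace ℝ F] [CompleteSpace F] {Ω : Set E}
    (hsc : IsSimplyConnected Ω) (ho : IsOpen Ω) {ω : E → E →L[ℝ] F} (hω : DifferentiableOn ℝ ω Ω)
    (hdω : ∀ a ∈ Ω, ∀ x y, fderiv ℝ ω a x y = fderiv ℝ ω a y x) :
    ∃ f : E → F, ∀ a ∈ Ω, HasFDerivAt f (ω a) a := by
  classical
  have := hsc.simplyConnectedSpace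
  have := ho.locallyPathConnectedSpace
  have hball : ∀ a : Ω, ∃ r > 0, Metric.ball (a : E) r ⊆ Ω := fun a => Metric.isOpen_iff.1 ho a a.2
  choose r hr hrΩ using hball
  have hloc : ∀ a : Ω, ∃ g : E → F, ∀ x ∈ Metric.ball (a : E) (r a), HasFDerivAt g (ω x) x :=
    fun a => (convex_ball _ _).exists_forall_hasFDerivAt_of_fderiv_symmetric Metric.isOpen_ball
      (hω.mono (hrΩ a)) fun x hx => hdω x (hrΩ a hx)
  choose g hg using hloc
  obtain ⟨Φ, hΦ⟩ := exists_locallyConstant_sub_of_simplyConnected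
    (fun a : Ω => ((↑) : Ω → E) ⁻¹' Metric.ball (a : E) (r a))
    (fun a => Metric.isOpen_ball.preimage continuous_subtype_val)
    (fun a => ⟨a, Metric.mem_ball_self (hr a)⟩) (fun a x => g a x) (by
      rintro a b x ⟨hxa, hxb⟩
      have hd : ∀ y ∈ Metric.ball (a : E) (r a) ∩ Metric.ball (b : E) (r b),
          HasFDerivAt (fun y => g a y - g b y) (0 : E →L[ℝ] F) y := fun y hy => by
        simpa using (hg a y hy.1).fun_sub (hg b y hy.2)
      have ho' := (Metric.isOpen_ball (x := (a : E)) (ε := r a)).inter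
        (Metric.isOpen_ball (x := (b : E)) (ε := r b))
      filter_upwards [continuous_subtype_val.continuousAt.preimage_mem_nhds
        (ho'.mem_nhds ⟨hxa, hxb⟩)] with y hy
      exact ho'.is_const_of_fderiv_eq_zero ((convex_ball _ _).inter (convex_ball _ _)).isPreconnected
        (fun z hz => (hd z hz).differentiableAt.differentiableWithinAt)
        (fun z hz => (hd z hz).fderiv) hy ⟨hxa, hxb⟩)
  refine ⟨fun x => if h : x ∈ Ω then Φ ⟨x, h⟩ else 0, fun a ha => ?_⟩
  have h1 := (eventually_nhds_subtype_iff Ω ⟨a, ha⟩ (fun y => (if h : y ∈ Ω then Φ ⟨y, h⟩ else 0)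
      - g ⟨a, ha⟩ y = Φ ⟨a, ha⟩ - g ⟨a, ha⟩ a)).1 (by
    filter_upwards [hΦ ⟨a, ha⟩ ⟨a, ha⟩ (Metric.mem_ball_self (hr _))] with y hy
    simpa using hy)
  rw [ho.nhdsWithin_eq ha] at h1
  refine ((hg ⟨a, ha⟩ a (Metric.mem_ball_self (hr _))).add_const
    (Φ ⟨a, ha⟩ - g ⟨a, ha⟩ a)).congr_of_eventuallyEq ?_
  filter_upwards [h1] with y hy
  rw [← hy]; abel

/-- Iterated line derivatives as used in `partialX` and `partialY` are values of the second Fréchet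
derivative; the direction of the outer derivative comes first. -/
theorem ContDiffOn.lineDeriv_lineDeriv_eq {E : Type*} [NormedAddCommGroup E] [NormedSpace ℝ E]
    {φ : E → ℝ} {Ω : Set E} (hφ : ContDiffOn ℝ 2 φ Ω) (ho : IsOpen Ω) {z : E} (hz : z ∈ Ω)
    (v w : E) :
    lineDeriv ℝ (fun x => lineDeriv ℝ φ x w) z v = fderiv ℝ (fderiv ℝ φ) z v w := by
  have h1 : (fun x => lineDeriv ℝ φ x w) =ᶠ[𝓝 z] fun x => fderiv ℝ φ x w := by
    filter_upwards [ho.mem_nhds hz] with x hx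
    exact ((hφ.contDiffAt (ho.mem_nhds hx)).differentiableAt (by norm_num)).lineDeriv_eq_fderiv
  have h2 : DifferentiableAt ℝ (fderiv ℝ φ) z :=
    ((hφ.contDiffAt (ho.mem_nhds hz)).fderiv_right (m := 1) (by norm_num)).differentiableAt
      (by norm_num)
  rw [h1.lineDeriv_eq, (h2.clm_apply (differentiableAt_const w)).lineDeriv_eq_fderiv,
    fderiv_clm_apply h2 (differentiableAt_const w)]
  simp

/-- Two real bilinear maps on `ℂⁿ` agree as soon as they agree on the vectors `∂/∂x_j` and
`∂/∂y_j`. -/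
theorem Complex.bilin_ext_single {n : ℕ} {B C : (Fin n → ℂ) →ₗ[ℝ] (Fin n → ℂ) →ₗ[ℝ] ℝ}
    (h : ∀ j k, ∀ a ∈ ({1, Complex.I} : Set ℂ), ∀ b ∈ ({1, Complex.I} : Set ℂ),
      B (Pi.single j a) (Pi.single k b) = C (Pi.single j a) (Pi.single k b)) : B = C := by
  refine LinearMap.pi_ext' fun j => Complex.basisOneI.ext fun a => ?_
  refine LinearMap.pi_ext' fun k => Complex.basisOneI.ext fun b => ?_
  fin_cases a <;> fin_cases b <;> simpa using h j k _ (by simp) _ (by simp)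

/-- The pluriharmonic equations say that the `1`-form `v ↦ -dφ(iv)` is closed. -/
theorem RealPluriharmonicOn.fderiv_fderiv_apply_I_smul {n : ℕ} {φ : (Fin n → ℂ) → ℝ}
    {Ω : Set (Fin n → ℂ)} (hφ : RealPluriharmonicOn φ Ω) (ho : IsOpen Ω) {z : Fin n → ℂ}
    (hz : z ∈ Ω) (v w : Fin n → ℂ) :
    fderiv ℝ (fderiv ℝ φ) z v (Complex.I • w) = fderiv ℝ (fderiv ℝ φ) z w (Complex.I • v) := by
  set D := fderiv ℝ (fderiv ℝ φ) z with hD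
  have hsymm : ∀ v w, D v w = D w v := by
    have := (hφ.contDiffOn.contDiffAt (ho.mem_nhds hz)).isSymmSndFDerivAt (by simp)
    exact fun v w => this.eq v w
  have hxx : ∀ j k, D (Pi.single j 1) (Pi.single k 1)
      = - D (Pi.single j Complex.I) (Pi.single k Complex.I) := fun j k => by
    rw [hD, ← hφ.contDiffOn.lineDeriv_lineDeriv_eq ho hz,
      ← hφ.contDiffOn.lineDeriv_lineDeriv_eq ho hz]
    exact eq_neg_of_add_eq_zero_left (hφ.eq_xx_yy z hz j k)
  have hxy : ∀ j k, D (Pi.single j 1) (Pi.single k Complex.I)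
      = D (Pi.single k 1) (Pi.single j Complex.I) := fun j k => by
    rw [hD, ← hφ.contDiffOn.lineDeriv_lineDeriv_eq ho hz,
      ← hφ.contDiffOn.lineDeriv_lineDeriv_eq ho hz]
    exact sub_eq_zero.1 (hφ.eq_xy_yx z hz j k)
  let J : (Fin n → ℂ) →ₗ[ℝ] (Fin n → ℂ) :=
    (LinearMap.lsmul ℂ (Fin n → ℂ) Complex.I).restrictScalars ℝ
  let B : (Fin n → ℂ) →ₗ[ℝ] (Fin n → ℂ) →ₗ[ℝ] ℝ := D.toLinearMap₁₂.compl₂ J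
  have hB : B = B.flip := by
    refine Complex.bilin_ext_single fun j k a ha b hb => ?_
    have hJ : ∀ (j : Fin n) (c : ℂ), Complex.I • (Pi.single j c : Fin n → ℂ)
        = Pi.single j (Complex.I * c) := fun j c => by rw [← Pi.single_smul, smul_eq_mul]
    change D (Pi.single j a) (Complex.I • Pi.single k b) =
      D (Pi.single k b) (Complex.I • Pi.single j a)
    rw [hJ, hJ]
    rcases ha with rfl | rfl <;> rcases hb with rfl | rfl
    · simpa using hxy j k
    · simpa [Pi.single_neg, hsymm (Pi.single k Complex.I)] using congrArg Neg.neg (hxx j k)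
    · simpa [Pi.single_neg, hsymm (Pi.single k 1)] using congrArg Neg.neg (hxx j k).symm
    · simpa [Pi.single_neg, hsymm _ (Pi.single _ (1 : ℂ))] using hxy k j
  exact congr($hB v w)

/-- On a simply connected open set, a pluriharmonic function is the real part of a holomorphic
function. -/
theorem RealPluriharmonicOn.exists_differentiableOn_re_eq {n : ℕ} {φ : (Fin n → ℂ) → ℝ}
    {Ω : Set (Fin n → ℂ)} (hφ : RealPluriharmonicOn φ Ω) (ho : IsOpen Ω)
    (hsc : IsSimplyConnected Ω) :
    ∃ H : (Fin n → ℂ) → ℂ, DifferentiableOn ℂ H Ω ∧ ∀ z ∈ Ω, (H z).re = φ z := by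
  let J : (Fin n → ℂ) →L[ℝ] (Fin n → ℂ) :=
    (ContinuousLinearMap.lsmul ℂ ℂ Complex.I).restrictScalars ℝ
  let T : ((Fin n → ℂ) →L[ℝ] ℝ) →L[ℝ] ((Fin n → ℂ) →L[ℝ] ℝ) :=
    -(ContinuousLinearMap.compL ℝ (Fin n → ℂ) (Fin n → ℂ) ℝ).flip J
  have hT : ∀ L v, T L v = -L (Complex.I • v) := fun L v => rfl
  have h2 : ∀ z ∈ Ω, DifferentiableAt ℝ (fderiv ℝ φ) z := fun z hz =>
    ((hφ.contDiffOn.contDiffAt (ho.mem_nhds hz)).fderiv_right (m := 1)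
      (by norm_num)).differentiableAt (by norm_num)
  obtain ⟨ψ, hψ⟩ := hsc.exists_forall_hasFDerivAt ho (ω := fun z => T (fderiv ℝ φ z))
    (fun z hz => (T.differentiableAt.comp z (h2 z hz)).differentiableWithinAt) (by
      intro z hz v w
      have h3 : fderiv ℝ (fun z => T (fderiv ℝ φ z)) z = T.comp (fderiv ℝ (fderiv ℝ φ) z) :=
        (T.hasFDerivAt.comp z (h2 z hz).hasFDerivAt).fderiv
      rw [h3]
      simp only [ContinuousLinearMap.comp_apply, hT, hφ.fderiv_fderiv_apply_I_smul ho hz v w])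
  refine ⟨fun z => φ z + ψ z * Complex.I, fun z hz => ?_, fun z hz => by simp⟩
  have hφ' : HasFDerivAt φ (fderiv ℝ φ z) z :=
    ((hφ.contDiffOn.contDiffAt (ho.mem_nhds hz)).differentiableAt (by norm_num)).hasFDerivAt
  have hH := (Complex.ofRealCLM.hasFDerivAt.comp z hφ').add
    ((Complex.ofRealCLM.hasFDerivAt.comp z (hψ z hz)).mul_const Complex.I)
  -- The real derivative of `φ + iψ` is complex linear: it commutes with multiplication by `i`.
  set L := Complex.ofRealCLM.comp (fderiv ℝ φ z) +
    Complex.I • Complex.ofRealCLM.comp (T (fderiv ℝ φ z)) with hL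
  have hLI : ∀ v, L (Complex.I • v) = Complex.I * L v := fun v => by
    have : Complex.I • Complex.I • v = -v := by rw [smul_smul, Complex.I_mul_I, neg_one_smul]
    simp only [hL, add_apply, smul_apply,
      ContinuousLinearMap.comp_apply, Complex.ofRealCLM_apply, hT, this, map_neg,
      smul_eq_mul]
    linear_combination ((fderiv ℝ φ z (Complex.I • v) : ℝ) : ℂ) * Complex.I_mul_I
  let L' : (Fin n → ℂ) →L[ℂ] ℂ :=
    { toFun := L
      map_add' := map_add L
      map_smul' := fun c v => by
        conv_lhs => rw [← Complex.re_add_im c, add_smul, mul_comm, mul_smul, map_add, hLI,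
          Complex.coe_smul, Complex.coe_smul, map_smul, map_smul]
        simp only [Complex.real_smul, RingHom.id_apply, smul_eq_mul]
        conv_rhs => rw [← Complex.re_add_im c]
        ring
      cont := L.continuous }
  have : HasFDerivAt (fun z => (φ z : ℂ) + ψ z * Complex.I) L' z :=
    hasFDerivAt_of_restrictScalars ℝ hH (by ext v; rfl)
  exact this.differentiableAt.differentiableWithinAt

theorem proposition1p2 {n : ℕ} (Ω : Set (Fin n → ℂ)) (hΩ_open : IsOpen Ω)
    (hΩ_sc : IsSimplyConnected Ω) (f : (Fin n → ℂ) → ℂ) (hf : ComplexPluriharmonicOn f Ω) :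
    ∃ h g : (Fin n → ℂ) → ℂ, DifferentiableOn ℂ h Ω ∧ DifferentiableOn ℂ g Ω ∧
      ∀ z ∈ Ω, f z = h z + (starRingEnd ℂ) (g z) := by
  obtain ⟨P, hP, hPre⟩ := hf.re.exists_differentiableOn_re_eq hΩ_open hΩ_sc
  obtain ⟨Q, hQ, hQre⟩ := hf.im.exists_differentiableOn_re_eq hΩ_open hΩ_sc
  -- `f = (P + conj P) / 2 + i (Q + conj Q) / 2`, and `i * conj Q = conj (-i * Q)`
  refine ⟨fun z => (P z + Complex.I * Q z) / 2, fun z => (P z - Complex.I * Q z) / 2,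
    by fun_prop, by fun_prop, fun z hz => ?_⟩
  apply Complex.ext
  · simp only [Complex.add_re, Complex.sub_re, Complex.conj_re, Complex.div_ofNat_re, hPre z hz]
    ring
  · simp only [Complex.add_im, Complex.sub_im, Complex.conj_im, Complex.div_ofNat_im,
      Complex.I_mul_im, hQre z hz]
    ring
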